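/- **Setting.** Let $C$ be a non-empty finite set of colors. A winning condition is a set $W\subseteq C^\omega$ of infinite words. A finite arena over $C$ is a finite directed graph with $C$-colored edges in which every node has an out-going edge and belongs to exactly one of two players, Alice and Bob. The game starts in a node; in each turn the owner of the current node chooses an out-going edge, and the play moves to its endpoint. A strategy of Alice (resp. Bob) is winning from a node $s$ w.r.t. $W$ if in every play from $s$ with this strategy the sequence of colors belongs to $W$ (resp. does not belong to $W$); it is positional if the chosen edge depends only on the current node. The condition $W$ is *half-positional* if in every finite arena over $C$ Alice has a positional strategy $\sigma$ such that, for every node $s$, if $\sigma$ is not winning from $s$, then Bob has a winning strategy from $s$. It is *bi-positional* if both $W$ and $C^\omega\setminus W$ are half-positional. It is *prefix-independent* if $\alpha\in W\iff x\alpha\in W$ for all $x\in C^*$, $\alpha\in C^\omega$. A prefix-independent $W$ is *permuting* if for every non-empty finite word $x$ and every word $y$ obtained from $x$ by permuting its letters, $x^\omega\in W$ implies $y^\omega\in W$. A *bi-order* on a group $G$ is a total order $\le$ such that $u\le v$ implies $xuy\le xvy$ for all $u,v,x,y\in G$. Let $F$ be the free group on two generators $a,b$, let $C=\{a,a^{-1},b,b^{-1},\varepsilon\}$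 with $\varepsilon$ the identity, and interpret each color as the corresponding element of $F$. For a bi-order $\le$ on $F$, let $W_1\subseteq C^\omega$ be the energy condition over $(F,\le)$: the set of all $c_1c_2c_3\ldots\in C^\omega$ for which the sequence of products $(c_1c_2\cdots c_n)_{n\ge 1}$ in $F$ has an infinite strictly decreasing subsequence w.r.t. $\le$. **Theorem.** 1. There is a bi-order on $F$, and it can be chosen so that $aba^{-1}b^{-1}$ is negative (that is, smaller than the identity). 2. For every bi-order $\le$ on $F$, the condition $W_1$ is bi-positional and prefix-independent, but not permuting. More precisely, if $aba^{-1}b^{-1}$ is negative, then $(aba^{-1}b^{-1})^\omega\in W_1$ while $(aa^{-1}bb^{-1})^\omega\notin W_1$. Otherwise its inverse $bab^{-1}a^{-1}$ is negative, and then $(bab^{-1}a^{-1})^\omega\in W_1$ while $(aa^{-1}bb^{-1})^\omega\notin W_1$. 3. Consequently, there is a bi-positional prefix-independent winning condition over a non-empty finite set of colors that is not permuting (which answers a question of Colcombet and Niwiński in the affirmative). -/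

import Mathlib

namespace EnergyGames

/-! Infinite words over `C` are elements of `Stream' C`, finite words are elements of `List C`.
`x ++ₛ α` is concatenation of a finite word with an infinite one, `Stream'.cycle x hx` is the
infinite repetition of the non-empty finite word `x`, and `α.take n` is the prefix of `α` of
length `n`. -/

/-! ## Arenas, plays and strategies -/

/-- The two players. -/
inductive Player where
  | alice
  | bob

/-- A `c`-colored arrow from `source` to `target`. -/
structure Edge (C V : Type*) where
  source : V
  col : C
  target : V

/-- An arena over the set of colors `C` with set of nodes `V`. Every node belongs to exactly one
of the players (so `V` is the disjoint union of Alice's nodes and of Bob's nodes), and every node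
has an out-going edge. Parallel edges with different colors are allowed. -/
structure Arena (C V : Type*) where
  owner : V → Player
  edges : Set (Edge C V)
  exists_edge : ∀ v : V, ∃ e ∈ edges, e.source = v

/-- The endpoint of a finite path that starts at the given node. -/
def endpoint {C V : Type*} : V → List (Edge C V) → V
  | s, [] => s
  | _, e :: h => endpoint e.target h

namespace Arena

variable {C V : Type*} (A : Arena C V)

/-- The list of edges is a path of the arena that starts at the given node. -/
def IsPathFrom : V → List (Edge C V) → Prop
  | _, [] => True
  | s, e :: h => e ∈ A.edges ∧ e.source = s ∧ IsPathFrom e.target h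

/-- A play from `s`: an infinite path of the arena that starts at `s`. -/
def IsPlayFrom (s : V) (p : Stream' (Edge C V)) : Prop :=
  (p.get 0).source = s ∧
    ∀ n, p.get n ∈ A.edges ∧ (p.get n).target = (p.get (n + 1)).source

/-- A strategy of player `P` in the game from `s`: to every finite path from `s` whose endpoint is
a node of `P` it assigns an edge out of that endpoint. Values of `move` on other lists are
irrelevant. -/
structure Strategy (P : Player) (s : V) where
  move : List (Edge C V) → Edge C V
  legal : ∀ h, A.IsPathFrom s h → A.owner (endpoint s h) = P →
    move h ∈ A.edges ∧ (move h).source = endpoint s h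

/-- A positional strategy of player `P`: to every node of `P` it assigns an edge out of this node.
Values of `move` on nodes of the opponent are irrelevant. -/
structure PositionalStrategy (P : Player) where
  move : V → Edge C V
  legal : ∀ v, A.owner v = P → move v ∈ A.edges ∧ (move v).source = v

variable {A}

/-- A positional strategy, viewed as a strategy in the game from `s`. -/
def PositionalStrategy.toStrategy {P : Player} (σ : A.PositionalStrategy P) (s : V) :
    A.Strategy P s where
  move h := σ.move (endpoint s h)
  legal h _ ho := σ.legal (endpoint s h) ho

/-- The play `p` is a play with the strategy `σ`: every turn of player `P` is made according
to `σ`. -/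
def Strategy.Consistent {P : Player} {s : V} (σ : A.Strategy P s) (p : Stream' (Edge C V)) :
    Prop :=
  ∀ n, A.owner (p.get n).source = P → p.get n = σ.move (p.take n)

end Arena

/-- The set of color sequences that are good for the given player: Alice wants the sequence of
colors to be in `W`, and Bob wants it to be outside `W`. -/
def goal {C : Type*} (W : Set (Stream' C)) : Player → Set (Stream' C)
  | Player.alice => W
  | Player.bob => Wᶜ

/-- The strategy `σ` in the game from `s` is winning with respect to `W`. -/
def Arena.Strategy.IsWinning {C V : Type*} {A : Arena C V} {P : Player} {s : V}
    (σ : A.Strategy P s) (W : Set (Stream' C)) : Prop :=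
  ∀ p : Stream' (Edge C V), A.IsPlayFrom s p → σ.Consistent p → p.map Edge.col ∈ goal W P

/-! ## Properties of winning conditions -/

/-- `W` is half-positional: in every finite arena, Alice has a positional strategy such that, from
every node from which it is not winning, Bob has a winning strategy. -/
def HalfPositional {C : Type*} (W : Set (Stream' C)) : Prop :=
  ∀ (V : Type) [Finite V] (A : Arena C V),
    ∃ σ : A.PositionalStrategy Player.alice, ∀ s : V,
      ¬ (σ.toStrategy s).IsWinning W → ∃ τ : A.Strategy Player.bob s, τ.IsWinning W

/-- `W` is bi-positional: both `W` and its complement are half-positional. -/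
def BiPositional {C : Type*} (W : Set (Stream' C)) : Prop :=
  HalfPositional W ∧ HalfPositional Wᶜ

/-- `W` is prefix-independent: adding or removing a finite prefix does not matter. -/
def PrefixIndependent {C : Type*} (W : Set (Stream' C)) : Prop :=
  ∀ (x : List C) (α : Stream' C), α ∈ W ↔ x ++ₛ α ∈ W

/-- `W` is permuting: it is closed under permuting periods of periodic sequences. -/
def Permuting {C : Type*} (W : Set (Stream' C)) : Prop :=
  ∀ (x y : List C) (hx : x ≠ []) (hy : y ≠ []), x.Perm y →
    Stream'.cycle x hx ∈ W → Stream'.cycle y hy ∈ W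

/-! ## Energy conditions over totally ordered groups -/

/-- The total order of `G` is invariant under left and right translations, that is, `G` is a
totally ordered (bi-ordered) group. -/
def IsBiOrdered (G : Type*) [Group G] [LinearOrder G] : Prop :=
  ∀ a b x y : G, a ≤ b → x * a * y ≤ x * b * y

/-- The valuation of a finite word: the product of the valuations of its letters, in order. -/
def wordVal {C G : Type*} [Group G] (val : C → G) (x : List C) : G :=
  (x.map val).prod

/-- The energy condition defined by the valuation `val`: the set of all infinite words for which
the sequence of valuations of non-empty finite prefixes has an infinite (strictly) decreasing
subsequence. -/
def energyCondition {C G : Type*} [Group G] [LinearOrder G] (val : C → G) : Set (Stream' C) :=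
  {α | ∃ k : ℕ → ℕ, StrictMono k ∧ StrictAnti fun i => wordVal val (α.take (k i + 1))}

/-! ## The condition over the free group with two generators -/

/-- The two generators. -/
inductive Gen where
  | a
  | b

/-- The free group with two generators. -/
abbrev F₂ : Type := FreeGroup Gen

/-- The generator `a` as an element of the free group. -/
def a : F₂ := FreeGroup.of Gen.a

/-- The generator `b` as an element of the free group. -/
def b : F₂ := FreeGroup.of Gen.b

/-- The five colors `a`, `a⁻¹`, `b`, `b⁻¹`, `ε`. -/
inductive Color where
  | a
  | aInv
  | b
  | bInv
  | eps

/-- Every color is interpreted as the corresponding element of the free group. -/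
def Color.val : Color → F₂
  | Color.a => EnergyGames.a
  | Color.aInv => EnergyGames.a⁻¹
  | Color.b => EnergyGames.b
  | Color.bInv => EnergyGames.b⁻¹
  | Color.eps => 1

/-- The energy condition over the free group with two generators, ordered by the given total
order. -/
def W₁ [LinearOrder F₂] : Set (Stream' Color) :=
  energyCondition Color.val

end EnergyGames

/-!
Call a winning condition decided by cycles if it is determined by the values of the closed walks in
plays: a class `S` of values is closed under products and conjugation, its complement is closed
under products, and a play all of whose infixes between two visits to the same state have values
in `S` (outside `S`) is good (bad); this is `IsCycleCondition`. An energy condition over a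
bi-ordered group is of this kind, with the negative elements as `S`
(`isCycleCondition_energyCondition`): conjugates of negative elements are negative because the order
is invariant on both sides, a sequence that strictly decreases along the visits to some state has
an infinite decreasing subsequence, and a sequence that is non-decreasing along the visits to each
of finitely many states has none. The notion is symmetric under complements, so half-positionality
has to be proved only once (`IsCycleCondition.halfPositional`).

Positional determinacy (`Arena.posDetermined`) is proved by induction on the set of edges. If a
player `P` has two edges at a node `v`, split the choices at `v` among two smaller arenas, which are
determined. If `P` wins from `v` in one of them, the strategies for this arena are also good for
the full one, since a winning play of the opponent there never meets `v`. If the opponent wins from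
`v` in both, the opponent wins in the full arena by remembering in which of the two arenas the last
move at `v` was (`Arena.memWins_of_split`): a closed walk of the resulting play is, up to
conjugation, a product of closed walks of the two arenas, and these have good values because the
play that repeats one of them is won. In all cases `P` has a positional strategy such that the
opponent wins, with memory, from wherever it fails. Doing this for both players gives two positional
strategies one of which wins from each node, as the players cannot both win from the same node.

To order the free group, map the generators to `1 + X E₁₂` and `1 + X E₂₁` in the group of units of
the polynomial ring over the `2 × 2` integer matrices. This map is injective, by the ping-pong lemma
at `X = 3`. Units `u` with constant coefficient `1` are bi-ordered by the sign of the lowest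
non-zero coefficient of `u - 1`, where matrices are ordered lexicographically
(`exists_isBiOrdered_of_polynomial_units`). The commutator of the generators is not `1`, so it is
negative after reversing the order if necessary, and rearranging its letters gives `1`, which is not
negative. Hence the condition is not permuting.
-/

namespace EnergyGames

/-! ### Winning conditions decided by the values of cycles -/

section CycleConditions

variable {C G : Type*} [Group G] {val : C → G}

lemma wordVal_append (val : C → G) (x y : List C) :
    wordVal val (x ++ y) = wordVal val x * wordVal val y := by
  simp [wordVal]

lemma wordVal_take_append (val : C → G) (x : List C) (α : Stream' C) (n : ℕ) :
    wordVal val ((x ++ₛ α).take (x.length + n)) = wordVal val x * wordVal val (α.take n) := by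
  rw [← wordVal_append]
  congr 1
  induction x with
  | nil => simp
  | cons c x ih =>
    rw [List.length_cons, show x.length + 1 + n = (x.length + n) + 1 by omega,
      Stream'.cons_append_stream, Stream'.take_succ_cons, ih, List.cons_append]

/-- The value of the prefix of length `n` of an infinite word. -/
def prefixVal (val : C → G) (α : Stream' C) (n : ℕ) : G :=
  wordVal val (α.take n)

/-- The value of the infix of an infinite word between the positions `i` and `j`, for `i ≤ j`. -/
def infixVal (val : C → G) (α : Stream' C) (i j : ℕ) : G :=
  (prefixVal val α i)⁻¹ * prefixVal val α j

@[simp] lemma prefixVal_zero (val : C → G) (α : Stream' C) : prefixVal val α 0 = 1 := by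
  simp [prefixVal, wordVal]

lemma prefixVal_succ (val : C → G) (α : Stream' C) (n : ℕ) :
    prefixVal val α (n + 1) = prefixVal val α n * val (α.get n) := by
  rw [prefixVal, Stream'.take_succ', wordVal_append]
  simp [prefixVal, wordVal]

@[simp] lemma infixVal_self (val : C → G) (α : Stream' C) (i : ℕ) : infixVal val α i i = 1 := by
  simp [infixVal]

lemma infixVal_succ (val : C → G) (α : Stream' C) (i j : ℕ) :
    infixVal val α i (j + 1) = infixVal val α i j * val (α.get j) := by
  simp [infixVal, prefixVal_succ, mul_assoc]

/-- The winning condition `W` is decided by the values of cycles, with `S` as the set of good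
values. In the two recurrence axioms, `q` records the states that some finite system visits while
it produces `α`: if all infixes of `α` between two visits to the same state have good values,
then `α` belongs to `W`, and if all of them have bad values, then it does not. -/
structure IsCycleCondition (val : C → G) (S : Set G) (W : Set (Stream' C)) : Prop where
  prefixIndependent : PrefixIndependent W
  mul_mem : ∀ g ∈ S, ∀ h ∈ S, g * h ∈ S
  mul_notMem : ∀ g ∉ S, ∀ h ∉ S, g * h ∉ S
  conj_mem : ∀ g ∈ S, ∀ x, x * g * x⁻¹ ∈ S
  mem_of_infixes : ∀ (α : Stream' C) (Q : Type) [Finite Q] (q : ℕ → Q),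
    (∀ i j, i < j → q i = q j → infixVal val α i j ∈ S) → α ∈ W
  notMem_of_infixes : ∀ (α : Stream' C) (Q : Type) [Finite Q] (q : ℕ → Q),
    (∀ i j, i < j → q i = q j → infixVal val α i j ∉ S) → α ∉ W

lemma prefixVal_add_of_periodic {α : Stream' C} {k : ℕ} (hα : ∀ n, α.get (n + k) = α.get n)
    (n : ℕ) : prefixVal val α (n + k) = prefixVal val α k * prefixVal val α n := by
  induction n with
  | zero => simp
  | succ n ih => rw [show n + 1 + k = n + k + 1 by omega, prefixVal_succ, ih, prefixVal_succ, hα,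
      mul_assoc]

lemma prefixVal_add_mul_of_periodic {α : Stream' C} {k : ℕ} (hα : ∀ n, α.get (n + k) = α.get n)
    (n m : ℕ) : prefixVal val α (n + k * m) = prefixVal val α k ^ m * prefixVal val α n := by
  induction m with
  | zero => simp
  | succ m ih => rw [show n + k * (m + 1) = n + k * m + k by ring, prefixVal_add_of_periodic hα,
      ih, pow_succ', mul_assoc]

namespace IsCycleCondition

variable {S : Set G} {W : Set (Stream' C)}

lemma compl (h : IsCycleCondition val S W) : IsCycleCondition val Sᶜ Wᶜ where
  prefixIndependent x α := not_congr (h.prefixIndependent x α)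
  mul_mem := h.mul_notMem
  mul_notMem g hg k hk := by
    simp only [Set.mem_compl_iff, not_not] at *
    exact h.mul_mem g hg k hk
  conj_mem g hg x hx := hg (by simpa [mul_assoc] using h.conj_mem _ hx x⁻¹)
  mem_of_infixes α Q _ q hq := h.notMem_of_infixes α Q q hq
  notMem_of_infixes α Q _ q hq := by
    simp only [Set.mem_compl_iff, not_not] at *
    exact h.mem_of_infixes α Q q hq

lemma pow_mem (h : IsCycleCondition val S W) {g : G} (hg : g ∈ S) (n : ℕ) : g ^ (n + 1) ∈ S := by
  induction n with
  | zero => simpa using hg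
  | succ n ih => rw [pow_succ]; exact h.mul_mem _ ih _ hg

/-- A periodic word with a good period is good: two positions that are congruent modulo the
period are separated by an infix whose value is conjugate to a power of the value of the
period. -/
lemma mem_of_periodic (h : IsCycleCondition val S W) {α : Stream' C} {k : ℕ} (hk : 0 < k)
    (hα : ∀ n, α.get (n + k) = α.get n) (hS : prefixVal val α k ∈ S) : α ∈ W := by
  refine h.mem_of_infixes α (Fin k) (fun n => ⟨n % k, Nat.mod_lt _ hk⟩) fun i j hij hq => ?_
  obtain ⟨m, hm⟩ := (Nat.modEq_iff_dvd' hij.le).1 (Fin.mk.inj_iff.1 hq)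
  obtain rfl : j = i + k * m := by omega
  obtain ⟨m, rfl⟩ : ∃ l, m = l + 1 := Nat.exists_eq_succ_of_ne_zero (by rintro rfl; simp at hij)
  have := h.conj_mem _ (h.pow_mem hS m) (prefixVal val α i)⁻¹
  rwa [inv_inv, mul_assoc, ← prefixVal_add_mul_of_periodic hα] at this

lemma mem_iff_of_periodic (h : IsCycleCondition val S W) {α : Stream' C} {k : ℕ} (hk : 0 < k)
    (hα : ∀ n, α.get (n + k) = α.get n) : α ∈ W ↔ prefixVal val α k ∈ S :=
  ⟨fun hW => by_contra fun hS => h.compl.mem_of_periodic hk hα hS hW, h.mem_of_periodic hk hα⟩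

lemma cycle_mem_iff (h : IsCycleCondition val S W) (x : List C) (hx : x ≠ []) :
    Stream'.cycle x hx ∈ W ↔ wordVal val x ∈ S := by
  have hc := Stream'.cycle_eq x hx
  rw [h.mem_iff_of_periodic (k := x.length) (List.length_pos_iff.2 hx), prefixVal, hc,
    ← Nat.add_zero x.length, wordVal_take_append, Stream'.take_zero,
    show wordVal val ([] : List C) = 1 from rfl, mul_one]
  intro n
  rw [Nat.add_comm, ← Stream'.get_drop]
  nth_rw 1 [hc]
  rw [Stream'.drop_append_stream]

end IsCycleCondition

end CycleConditions

/-! ### Energy conditions are decided by the values of cycles -/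

section Energy

variable {C G : Type*} [Group G] [LinearOrder G]

lemma IsBiOrdered.mulLeftMono (h : IsBiOrdered G) : MulLeftMono G :=
  ⟨fun x a b hab => by simpa using h a b x 1 hab⟩

lemma IsBiOrdered.mulRightMono (h : IsBiOrdered G) : MulRightMono G :=
  ⟨fun x a b hab => by simpa using h a b 1 x hab⟩

lemma prefixIndependent_energyCondition (hG : IsBiOrdered G) (val : C → G) :
    PrefixIndependent (energyCondition val) := by
  have := hG.mulLeftMono
  intro x α
  constructor
  · rintro ⟨k, hk, hanti⟩
    refine ⟨fun i => x.length + k i, fun i j hij => Nat.add_lt_add_left (hk hij) _,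
      fun i j hij => ?_⟩
    simp only [Nat.add_assoc, wordVal_take_append]
    exact mul_lt_mul_right (hanti hij) _
  · rintro ⟨k, hk, hanti⟩
    -- From the index `x.length` on, the chosen positions lie in `α`.
    have hle : ∀ i, x.length ≤ k (i + x.length) := fun i => by
      have := hk.id_le (i + x.length)
      simp only [id] at this
      omega
    have hlt : ∀ {i j}, i < j → k (i + x.length) < k (j + x.length) := fun hij => hk (by omega)
    refine ⟨fun i => k (i + x.length) - x.length, fun i j hij => ?_, fun i j hij => ?_⟩
    · have := hlt hij
      have := hle i
      show k (i + x.length) - x.length < k (j + x.length) - x.length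
      omega
    · have := hanti (show i + x.length < j + x.length by omega)
      have h : ∀ i, k (i + x.length) + 1 = x.length + (k (i + x.length) - x.length + 1) :=
        fun i => by have := hle i; omega
      simp only [h, wordVal_take_append] at this
      exact lt_of_mul_lt_mul_left' this

/-- Energy conditions over bi-ordered groups are decided by cycles, and the good values are the
negative ones. Negativity is invariant under conjugation because the order is invariant under
both translations. -/
theorem isCycleCondition_energyCondition (hG : IsBiOrdered G) (val : C → G) :
    IsCycleCondition val {g | g < 1} (energyCondition val) := by
  have := hG.mulLeftMono
  have := hG.mulRightMono
  refine ⟨prefixIndependent_energyCondition hG val, fun g hg h hh => mul_lt_one hg hh,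
    fun g hg h hh => ?_, fun g hg x => ?_, fun α Q _ q hq => ?_, fun α Q _ q hq => ?_⟩
  · simp only [Set.mem_ofPred_eq, not_lt] at *
    exact one_le_mul hg hh
  · have : x * g * x⁻¹ < x * 1 * x⁻¹ := mul_lt_mul_left (mul_lt_mul_right hg x) x⁻¹
    simpa using this
  · -- Some state is visited infinitely often, and the values decrease along its visits.
    obtain ⟨s, hs⟩ := Finite.exists_infinite_fiber fun n => q (n + 1)
    have hs' : (((fun n => q (n + 1)) ⁻¹' {s} : Set ℕ)).Infinite := Set.infinite_coe_iff.1 hs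
    refine ⟨Nat.nth (· ∈ (fun n => q (n + 1)) ⁻¹' {s}), Nat.nth_strictMono hs', fun i j hij => ?_⟩
    have hmem := fun i => Nat.nth_mem_of_infinite hs' i
    have := hq _ _ (Nat.add_lt_add_right (Nat.nth_strictMono hs' hij) 1)
      ((hmem i).trans (hmem j).symm)
    exact inv_mul_lt_one_iff.1 this
  · rintro ⟨k, hk, hanti⟩
    obtain ⟨i, j, hij, hne⟩ : ∃ i j, i < j ∧ q (k i + 1) = q (k j + 1) := by
      obtain ⟨i, j, hne, he⟩ := Finite.exists_ne_map_eq_of_infinite fun i => q (k i + 1)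
      rcases lt_or_gt_of_ne hne with h | h
      · exact ⟨i, j, h, he⟩
      · exact ⟨j, i, h, he.symm⟩
    exact hq _ _ (Nat.add_lt_add_right (hk hij) 1) hne (inv_mul_lt_one_iff.2 (hanti hij))

end Energy

/-! ### Bi-orders from embeddings into units of polynomial rings -/

section LowestCoefficient

open Polynomial

variable {R L : Type*} [Ring R] [AddCommGroup L] [LinearOrder L]

/-- The lowest non-zero coefficient of the polynomial `p` is positive, where the sign of an
element of `R` is that of its image under the additive map `i` to an ordered group. -/
def LowestCoeffPos (i : R →+ L) (p : R[X]) : Prop :=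
  ∃ (n : ℕ) (q : R[X]), p = X ^ n * q ∧ 0 < i (q.coeff 0)

variable {i : R →+ L}

lemma not_lowestCoeffPos_zero : ¬ LowestCoeffPos i (0 : R[X]) := by
  rintro ⟨n, q, h, hq⟩
  have : q = 0 := by
    ext d
    simpa using (congrArg (fun p => coeff p (d + n)) h).symm
  simp [this] at hq

lemma lowestCoeffPos_or_neg [IsOrderedAddMonoid L] (hi : Function.Injective i) {p : R[X]}
    (hp : p ≠ 0) :
    LowestCoeffPos i p ∨ LowestCoeffPos i (-p) := by
  obtain ⟨q, hq⟩ := X_pow_dvd_iff.2 fun d hd => coeff_eq_zero_of_lt_natTrailingDegree (p := p) hd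
  have hq0 : i (q.coeff 0) ≠ 0 := by
    rw [Ne, map_eq_zero_iff i hi, ← coeff_X_pow_mul q p.natTrailingDegree 0, ← hq, zero_add]
    simpa [trailingCoeff] using hp
  rcases lt_or_gt_of_ne hq0 with h | h
  · exact Or.inr ⟨_, -q, by rw [mul_neg, ← hq], by simpa using h⟩
  · exact Or.inl ⟨_, q, hq, h⟩

/-- Multiplication by polynomials with constant coefficient `1` does not change the lowest
non-zero coefficient. -/
lemma LowestCoeffPos.mul_mul {p u v : R[X]} (hp : LowestCoeffPos i p) (hu : u.coeff 0 = 1)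
    (hv : v.coeff 0 = 1) : LowestCoeffPos i (u * p * v) := by
  obtain ⟨n, q, rfl, hq⟩ := hp
  refine ⟨n, u * q * v, by rw [← mul_assoc u, ← X_pow_mul]; simp only [mul_assoc], ?_⟩
  simpa [mul_coeff_zero, hu, hv] using hq

lemma LowestCoeffPos.mul_sub_one [IsOrderedAddMonoid L] {u v : R[X]} (hu : LowestCoeffPos i (u - 1))
    (hv : LowestCoeffPos i (v - 1)) (hu0 : u.coeff 0 = 1) :
    LowestCoeffPos i (u * v - 1) := by
  obtain ⟨n, p, hp, hp0⟩ := hu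
  obtain ⟨m, q, hq, hq0⟩ := hv
  have hX : ∀ k, u * X ^ k = X ^ k * u := fun k => X_pow_mul.symm
  -- Factor out the smaller power of `X` from `u * v - 1 = u * (v - 1) + (u - 1)`.
  rcases lt_or_ge n m with h | h
  · obtain ⟨k, rfl⟩ := Nat.exists_eq_add_of_lt h
    refine ⟨n, u * (X ^ (k + 1) * q) + p, ?_, ?_⟩
    · rw [show u * v - 1 = u * (v - 1) + (u - 1) by noncomm_ring, hp, hq, mul_add,
        ← mul_assoc (X ^ n) u, ← hX, add_assoc n, pow_add]
      simp only [mul_assoc]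
    · simpa [mul_coeff_zero] using hp0
  · obtain ⟨k, rfl⟩ := Nat.exists_eq_add_of_le h
    refine ⟨m, u * q + X ^ k * p, ?_, ?_⟩
    · rw [show u * v - 1 = u * (v - 1) + (u - 1) by noncomm_ring, hp, hq, mul_add,
        ← mul_assoc (X ^ m) u, ← hX, pow_add]
      simp only [mul_assoc]
    · rcases Nat.eq_zero_or_pos k with rfl | hk
      · simpa [mul_coeff_zero, hu0] using add_pos hq0 hp0
      · simpa [mul_coeff_zero, hu0, coeff_X_pow, hk.ne] using hq0

/-- A group is bi-orderable if it embeds into the group of those units of `R[X]` that have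
constant coefficient `1`, where `R` is a ring, not necessarily commutative, whose additive group
is orderable: an element `u ≠ 1` is positive if the lowest non-zero coefficient of `u - 1` is. -/
theorem exists_isBiOrdered_of_polynomial_units [IsOrderedAddMonoid L]
    (hi : Function.Injective i) {G : Type*} [Group G]
    (f : G →* R[X]ˣ) (hf : Function.Injective f) (h0 : ∀ g, (f g : R[X]).coeff 0 = 1) :
    ∃ _ : LinearOrder G, IsBiOrdered G := by
  classical
  let pos : G → Prop := fun g => LowestCoeffPos i ((f g : R[X]) - 1)
  have pos_one : ¬ pos 1 := by simpa [pos] using not_lowestCoeffPos_zero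
  have pos_mul : ∀ {g h}, pos g → pos h → pos (g * h) := fun {g h} hg hh => by
    simpa [pos] using hg.mul_sub_one hh (h0 g)
  have pos_conj : ∀ {g} (x), pos g → pos (x * g * x⁻¹) := fun {g} x hg => by
    have := hg.mul_mul (h0 x) (h0 x⁻¹)
    simpa [pos, mul_sub, sub_mul] using this
  have pos_or : ∀ {g}, g ≠ 1 → pos g ∨ pos g⁻¹ := fun {g} hg => by
    have hne : (f g : R[X]) - 1 ≠ 0 := by
      rw [sub_ne_zero, Ne, Units.val_eq_one, map_eq_one_iff f hf]
      exact hg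
    refine (lowestCoeffPos_or_neg hi hne).imp_right fun h => ?_
    have := h.mul_mul (u := 1) (by simp) (h0 g⁻¹)
    simpa [pos, sub_mul] using this
  let _ : LinearOrder G :=
    { le g h := g = h ∨ pos (g⁻¹ * h)
      le_refl g := Or.inl rfl
      le_trans g h k := by
        rintro (rfl | hgh) (rfl | hhk)
        · exact Or.inl rfl
        · exact Or.inr hhk
        · exact Or.inr hgh
        · exact Or.inr (by simpa [mul_assoc] using pos_mul hgh hhk)
      le_antisymm g h := by
        rintro (rfl | hgh) (hhk | hhk)
        · rfl
        · rfl
        · exact hhk.symm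
        · exact (pos_one (by simpa [mul_assoc] using pos_mul hgh hhk)).elim
      le_total g h := by
        rcases eq_or_ne g h with rfl | hne
        · exact Or.inl (Or.inl rfl)
        · refine (pos_or (g := g⁻¹ * h) ?_).imp Or.inr fun h => Or.inr (by simpa using h)
          rwa [Ne, inv_mul_eq_one]
      toDecidableLE := Classical.decRel _ }
  refine ⟨inferInstance, fun g h x y hgh => ?_⟩
  rcases hgh with rfl | hgh
  · exact Or.inl rfl
  · exact Or.inr (by simpa [mul_assoc] using pos_conj y⁻¹ hgh)

end LowestCoefficient

/-! ### The free group with two generators is bi-orderable -/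

section FreeGroup

open Polynomial

/-- The endomorphisms of `ℤ²` with matrices `E₁₂` and `E₂₁`. -/
def shear : Gen → Module.End ℤ (ℤ × ℤ)
  | Gen.a => LinearMap.inl ℤ ℤ ℤ ∘ₗ LinearMap.snd ℤ ℤ ℤ
  | Gen.b => LinearMap.inr ℤ ℤ ℤ ∘ₗ LinearMap.fst ℤ ℤ ℤ

lemma shear_mul_self (x : Gen) : shear x * shear x = 0 := by
  cases x <;> ext <;> simp [shear]

lemma C_shear_mul_X_mul_self (x : Gen) : C (shear x) * X * (C (shear x) * X) = 0 := by
  rw [mul_assoc, ← mul_assoc X, X_mul_C, mul_assoc, ← mul_assoc, ← C_mul, shear_mul_self]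
  simp

/-- The unit `1 + X E` of the polynomial ring over the endomorphisms of `ℤ²`, where `E` is the
endomorphism attached to a generator. Its inverse is `1 - X E`, because `E² = 0`. -/
noncomputable def shearUnit (x : Gen) : (Module.End ℤ (ℤ × ℤ))[X]ˣ where
  val := 1 + C (shear x) * X
  inv := 1 - C (shear x) * X
  val_inv := by
    rw [mul_sub, mul_one, add_mul, one_mul, C_shear_mul_X_mul_self, add_zero,
      add_sub_cancel_right]
  inv_val := by
    rw [sub_mul, one_mul, mul_add, mul_one, C_shear_mul_X_mul_self, add_zero,
      add_sub_cancel_right]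

/-- Evaluation of polynomials over the endomorphisms of `ℤ²` at the scalar `3`. -/
noncomputable def evalThree : (Module.End ℤ (ℤ × ℤ))[X] →+* Module.End ℤ (ℤ × ℤ) :=
  eval₂RingHom' (RingHom.id _) 3 fun _ => Commute.ofNat_right _ _

lemma evalThree_C_shear_mul_X (x : Gen) : evalThree (C (shear x) * X) = shear x * 3 := by
  simp [evalThree]

/-- The units `1 + 3 E` of the ring of endomorphisms of `ℤ²`. -/
noncomputable def shearThree (x : Gen) : (Module.End ℤ (ℤ × ℤ))ˣ :=
  Units.map evalThree.toMonoidHom (shearUnit x)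

lemma shearThree_apply (x : Gen) (v : ℤ × ℤ) :
    (shearThree x : Module.End ℤ (ℤ × ℤ)) v = v + (3 : ℤ) • shear x v := by
  have : (shearThree x : Module.End ℤ (ℤ × ℤ)) = 1 + shear x * 3 := by
    rw [← evalThree_C_shear_mul_X, ← map_one evalThree, ← map_add]
    rfl
  rw [this]
  cases x <;> ext <;> simp [shear]

lemma shearThree_inv_apply (x : Gen) (v : ℤ × ℤ) :
    ((shearThree x)⁻¹ : (Module.End ℤ (ℤ × ℤ))ˣ).val v = v - (3 : ℤ) • shear x v := by
  have : ((shearThree x)⁻¹ : (Module.End ℤ (ℤ × ℤ))ˣ).val = 1 - shear x * 3 := by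
    rw [← evalThree_C_shear_mul_X, ← map_one evalThree, ← map_sub]
    rfl
  rw [this]
  cases x <;> ext <;> simp [shear]

/-- The ping-pong table of `1 + 3 E`: for `a`, the vectors `(x, y)` with `|y| < |x|` and
`0 ≤ x y`, and for `b` the same with the coordinates exchanged. The conditions are spelled out
linearly. -/
def pingSet : Gen → Set {v : ℤ × ℤ // v ≠ 0}
  | Gen.a => {v | (0 ≤ v.1.2 ∧ v.1.2 < v.1.1) ∨ (v.1.2 ≤ 0 ∧ v.1.1 < v.1.2)}
  | Gen.b => {v | (0 ≤ v.1.1 ∧ v.1.1 < v.1.2) ∨ (v.1.1 ≤ 0 ∧ v.1.2 < v.1.1)}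

/-- The ping-pong table of `(1 + 3 E)⁻¹`: for `a`, the vectors `(x, y)` with `|y| < |x|` and
`x y < 0`, and for `b` the same with the coordinates exchanged. -/
def pongSet : Gen → Set {v : ℤ × ℤ // v ≠ 0}
  | Gen.a => {v | (v.1.2 < 0 ∧ -v.1.2 < v.1.1) ∨ (0 < v.1.2 ∧ v.1.1 < -v.1.2)}
  | Gen.b => {v | (v.1.1 < 0 ∧ -v.1.1 < v.1.2) ∨ (0 < v.1.1 ∧ v.1.2 < -v.1.1)}

lemma ne_zero_pair (v : {v : ℤ × ℤ // v ≠ 0}) : v.1.1 ≠ 0 ∨ v.1.2 ≠ 0 := by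
  by_contra! h
  exact v.2 (Prod.ext h.1 h.2)

open scoped Function Pointwise in
lemma injective_lift_shearThree : Function.Injective (FreeGroup.lift shearThree) := by
  have : Nontrivial Gen := ⟨Gen.a, Gen.b, by simp⟩
  refine FreeGroup.injective_lift_of_ping_pong (α := {v : ℤ × ℤ // v ≠ 0}) shearThree pingSet
    pongSet ?_ ?_ ?_ ?_ ?_ ?_
  · rintro (_ | _)
    · exact ⟨⟨(1, 0), by simp⟩, by simp [pingSet]⟩
    · exact ⟨⟨(0, 1), by simp⟩, by simp [pingSet]⟩
  · rintro (_ | _) (_ | _) h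
    all_goals first | exact (h rfl).elim | skip
    all_goals
      refine Set.disjoint_left.2 fun v hv hv' => ?_
      simp only [pingSet, Set.mem_ofPred_eq] at hv hv'
      omega
  · rintro (_ | _) (_ | _) h
    all_goals first | exact (h rfl).elim | skip
    all_goals
      refine Set.disjoint_left.2 fun v hv hv' => ?_
      simp only [pongSet, Set.mem_ofPred_eq] at hv hv'
      omega
  · rintro (_ | _) (_ | _)
    all_goals
      refine Set.disjoint_left.2 fun v hv hv' => ?_
      simp only [pingSet, pongSet, Set.mem_ofPred_eq] at hv hv'
      omega
  · rintro x _ ⟨v, hv, rfl⟩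
    have h0 := ne_zero_pair v
    have h : (shearThree x • v).1 = v.1 + (3 : ℤ) • shear x v.1 := shearThree_apply x v.1
    cases x <;>
    · simp only [shear, LinearMap.comp_apply, LinearMap.fst_apply, LinearMap.snd_apply,
        LinearMap.inl_apply, LinearMap.inr_apply] at h
      simp only [pingSet, pongSet, Set.mem_compl_iff, Set.mem_ofPred_eq, h, Prod.fst_add,
        Prod.snd_add, Prod.smul_fst, Prod.smul_snd, smul_eq_mul] at hv ⊢
      omega
  · rintro x _ ⟨v, hv, rfl⟩
    have h0 := ne_zero_pair v
    have h : ((shearThree x)⁻¹ • v).1 = v.1 - (3 : ℤ) • shear x v.1 := shearThree_inv_apply x v.1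
    cases x <;>
    · simp only [shear, LinearMap.comp_apply, LinearMap.fst_apply, LinearMap.snd_apply,
        LinearMap.inl_apply, LinearMap.inr_apply] at h
      simp only [pingSet, pongSet, Set.mem_compl_iff, Set.mem_ofPred_eq, Pi.inv_apply, h,
        Prod.fst_sub, Prod.snd_sub, Prod.smul_fst, Prod.smul_snd, smul_eq_mul] at hv ⊢
      omega

/-- The homomorphism from the free group that maps each generator to its unit `1 + X E`. -/
noncomputable def shearHom : F₂ →* (Module.End ℤ (ℤ × ℤ))[X]ˣ :=
  FreeGroup.lift shearUnit

/-- Already the specialization at `X = 3` is injective. -/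
lemma injective_shearHom : Function.Injective shearHom := by
  have : (Units.map evalThree.toMonoidHom).comp shearHom = FreeGroup.lift shearThree := by
    ext1 x
    simp [shearHom, shearThree]
  refine Function.Injective.of_comp (f := Units.map evalThree.toMonoidHom) ?_
  rw [← MonoidHom.coe_comp, this]
  exact injective_lift_shearThree

lemma coeff_zero_shearHom (g : F₂) : (shearHom g : (Module.End ℤ (ℤ × ℤ))[X]).coeff 0 = 1 := by
  induction g using FreeGroup.induction_on with
  | C1 => simp
  | of x => simp [shearHom, shearUnit]
  | inv_of x _ =>
    rw [map_inv, shearHom, FreeGroup.lift_apply_of]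
    simp [shearUnit, Units.inv_mk]
  | mul g h hg hh => simp [mul_coeff_zero, hg, hh]

/-- An endomorphism of `ℤ²`, as the lexicographically ordered list of its matrix entries. -/
def entries : Module.End ℤ (ℤ × ℤ) →+ Lex (Fin 4 → ℤ) where
  toFun f := toLex ![(f (1, 0)).1, (f (1, 0)).2, (f (0, 1)).1, (f (0, 1)).2]
  map_zero' := by
    refine congrArg toLex (funext fun j => ?_)
    fin_cases j <;> rfl
  map_add' f g := by
    refine congrArg toLex (funext fun j => ?_)
    fin_cases j <;> rfl

lemma injective_entries : Function.Injective entries := by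
  intro f g h
  have h := congrArg ofLex h
  have h0 : (f (1, 0)).1 = (g (1, 0)).1 := congrFun h 0
  have h1 : (f (1, 0)).2 = (g (1, 0)).2 := congrFun h 1
  have h2 : (f (0, 1)).1 = (g (0, 1)).1 := congrFun h 2
  have h3 : (f (0, 1)).2 = (g (0, 1)).2 := congrFun h 3
  ext <;> simp [*]

theorem exists_isBiOrdered_freeGroup : ∃ _ : LinearOrder F₂, IsBiOrdered F₂ :=
  exists_isBiOrdered_of_polynomial_units injective_entries shearHom injective_shearHom
    coeff_zero_shearHom

lemma commutator_ne_one : a * b * a⁻¹ * b⁻¹ ≠ 1 := by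
  intro h
  -- The images of `a` and `b` under a map to the symmetric group `S₃` do not commute.
  have := congrArg (FreeGroup.lift fun x : Gen =>
    (match x with | Gen.a => Equiv.swap 0 1 | Gen.b => Equiv.swap 1 2 : Equiv.Perm (Fin 3))) h
  simp only [a, b, map_mul, map_inv, FreeGroup.lift_apply_of, map_one] at this
  revert this
  decide

/-- The commutator of the generators is negative for a suitable bi-order: if it is positive for
some bi-order, then it is negative for the reversed one. -/
theorem exists_isBiOrdered_commutator_lt_one :
    ∃ _ : LinearOrder F₂, IsBiOrdered F₂ ∧ a * b * a⁻¹ * b⁻¹ < 1 := by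
  obtain ⟨ord, hord⟩ := exists_isBiOrdered_freeGroup
  rcases lt_trichotomy (a * b * a⁻¹ * b⁻¹) 1 with h | h | h
  · exact ⟨ord, hord, h⟩
  · exact (commutator_ne_one h).elim
  · exact ⟨inferInstanceAs (LinearOrder F₂ᵒᵈ), fun g h x y hgh => hord h g x y hgh, h⟩

end FreeGroup

/-! ### Positional strategies and strategies with memory -/

/-- The opponent of a player. -/
def Player.opp : Player → Player
  | Player.alice => Player.bob
  | Player.bob => Player.alice

lemma Player.eq_or_eq_opp (P Q : Player) : Q = P ∨ Q = P.opp := by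
  cases P <;> cases Q <;> simp [Player.opp]

lemma Player.opp_ne (P : Player) : P.opp ≠ P := by
  cases P <;> simp [Player.opp]

lemma goal_opp {C : Type*} (W : Set (Stream' C)) (P : Player) : goal W P.opp = (goal W P)ᶜ := by
  cases P <;> simp [Player.opp, goal]

/-- The values of cycles that are good for the given player. -/
def goalValues {G : Type*} (S : Set G) : Player → Set G
  | Player.alice => S
  | Player.bob => Sᶜ

lemma IsCycleCondition.player {C G : Type*} [Group G] {val : C → G} {S : Set G}
    {W : Set (Stream' C)} (h : IsCycleCondition val S W) (P : Player) :
    IsCycleCondition val (goalValues S P) (goal W P) := by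
  cases P
  · exact h
  · exact h.compl

namespace Arena

variable {C V : Type} {A : Arena C V} {W : Set (Stream' C)} {P : Player} {f : V → Edge C V}

/-- The map `f` prescribes a move to the player `P` at each of the nodes of `P`. -/
def IsLegal (A : Arena C V) (P : Player) (f : V → Edge C V) : Prop :=
  ∀ v, A.owner v = P → f v ∈ A.edges ∧ (f v).source = v

/-- The edge `e` belongs to the arena, and it respects the choices `f` of the player `P`. -/
def Allowed (A : Arena C V) (P : Player) (f : V → Edge C V) (e : Edge C V) : Prop :=
  e ∈ A.edges ∧ (A.owner e.source = P → e = f e.source)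

/-- The player `P` wins from the node `s` by the choices `f`. -/
def PosWins (A : Arena C V) (W : Set (Stream' C)) (P : Player) (f : V → Edge C V) (s : V) :
    Prop :=
  ∀ p : Stream' (Edge C V), A.IsPlayFrom s p → (∀ n, A.Allowed P f (p.get n)) →
    p.map Edge.col ∈ goal W P

/-- The player `P` has a winning strategy from the node `s` that is based on a memory, possibly
infinite: the memory state is updated with every edge of the play, and a move of `P` depends on
the memory state and on the current node. -/
def MemWins (A : Arena C V) (W : Set (Stream' C)) (P : Player) (s : V) : Prop :=
  ∃ (M : Type) (m₀ : M) (upd : M → Edge C V → M) (move : M → V → Edge C V),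
    (∀ m, A.IsLegal P (move m)) ∧
    ∀ (p : Stream' (Edge C V)) (m : ℕ → M), A.IsPlayFrom s p → m 0 = m₀ →
      (∀ n, m (n + 1) = upd (m n) (p.get n)) →
      (∀ n, A.Allowed P (move (m n)) (p.get n)) → p.map Edge.col ∈ goal W P

lemma exists_isLegal (A : Arena C V) (P : Player) : ∃ f, A.IsLegal P f := by
  choose f hf using A.exists_edge
  exact ⟨f, fun v _ => hf v⟩

lemma IsLegal.mono {B : Arena C V} (hf : B.IsLegal P f) (hown : B.owner = A.owner)
    (hsub : B.edges ⊆ A.edges) : A.IsLegal P f := fun v hv =>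
  ⟨hsub (hf v (by rwa [hown])).1, (hf v (by rwa [hown])).2⟩

lemma PosWins.memWins {s : V} (h : A.PosWins W P f s) (hf : A.IsLegal P f) :
    A.MemWins W P s :=
  ⟨Unit, (), fun _ _ => (), fun _ => f, fun _ => hf, fun p _ hp _ _ hc => h p hp hc⟩

/-- Two strategies of opposite players determine a play, so that they cannot both be winning. -/
lemma MemWins.not_opp {s : V} (h : A.MemWins W P s) : ¬ A.MemWins W P.opp s := by
  classical
  rintro ⟨M', m₀', upd', move', hl', hw'⟩
  obtain ⟨M, m₀, upd, move, hl, hw⟩ := h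
  let e : V × M × M' → Edge C V := fun x =>
    if A.owner x.1 = P then move x.2.1 x.1 else move' x.2.2 x.1
  let st : ℕ → V × M × M' := fun n => Nat.rec (s, m₀, m₀')
    (fun _ x => ((e x).target, upd x.2.1 (e x), upd' x.2.2 (e x))) n
  have he : ∀ x, e x ∈ A.edges ∧ (e x).source = x.1 := by
    intro x
    simp only [e]
    split_ifs with hx
    · exact hl _ _ hx
    · exact hl' _ _ ((P.eq_or_eq_opp _).resolve_left hx)
  let p : Stream' (Edge C V) := fun n => e (st n)
  have hp : A.IsPlayFrom s p := ⟨(he _).2, fun n => ⟨(he _).1, (he (st (n + 1))).2.symm⟩⟩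
  have h1 := hw p (fun n => (st n).2.1) hp rfl (fun _ => rfl) fun n => by
    refine ⟨(he _).1, fun ho => ?_⟩
    change A.owner (e (st n)).source = P at ho
    change e (st n) = move (st n).2.1 (e (st n)).source
    rw [(he _).2] at ho ⊢
    exact if_pos ho
  have h2 := hw' p (fun n => (st n).2.2) hp rfl (fun _ => rfl) fun n => by
    refine ⟨(he _).1, fun ho => ?_⟩
    change A.owner (e (st n)).source = P.opp at ho
    change e (st n) = move' (st n).2.2 (e (st n)).source
    rw [(he _).2] at ho ⊢
    exact if_neg fun h => P.opp_ne (ho.symm.trans h)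
  rw [goal_opp] at h2
  exact h2 h1

lemma PosWins.target (hW : PrefixIndependent (goal W P)) {e : Edge C V}
    (h : A.PosWins W P f e.source) (he : A.Allowed P f e) : A.PosWins W P f e.target := by
  intro p hp hc
  rw [hW [e.col], Stream'.cons_append_stream, Stream'.nil_append_stream, ← Stream'.map_cons]
  refine h (Stream'.cons e p) ⟨rfl, ?_⟩ ?_
  · rintro (_ | n)
    · exact ⟨he.1, hp.1.symm⟩
    · exact hp.2 n
  · rintro (_ | n)
    · exact he
    · exact hc n

/-- A player without any choice either wins from `s`, or there is a play from `s` that is good for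
the opponent; the latter can follow this play, with the number of moves made as the memory. -/
lemma posWins_or_memWins_of_unique
    (hu : ∀ e ∈ A.edges, ∀ e' ∈ A.edges, A.owner e.source = P → e.source = e'.source → e = e')
    (s : V) : A.PosWins W P f s ∨ A.MemWins W P.opp s := by
  classical
  rw [or_iff_not_imp_left]
  intro h
  simp only [PosWins, not_forall] at h
  obtain ⟨p, hp, -, hlose⟩ := h
  obtain ⟨g, hg⟩ := A.exists_isLegal P.opp
  refine ⟨ℕ, 0, fun n _ => n + 1, fun n v => if (p.get n).source = v then p.get n else g v,
    fun n v hv => ?_, fun p' m hp' hm0 hm hc => ?_⟩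
  · dsimp only
    split_ifs with h
    · exact ⟨(hp.2 n).1, h⟩
    · exact hg v hv
  · have hmn : ∀ n, m n = n := fun n => by
      induction n with
      | zero => exact hm0
      | succ n ih => rw [hm, ih]
    have hstep : ∀ n, (p.get n).source = (p'.get n).source → p'.get n = p.get n := fun n hn => by
      rcases P.eq_or_eq_opp (A.owner (p'.get n).source) with ho | ho
      · exact hu _ (hp'.2 n).1 _ (hp.2 n).1 ho hn.symm
      · rw [(hc n).2 ho, hmn]
        exact if_pos hn
    have heq : ∀ n, p'.get n = p.get n := fun n => by
      induction n with
      | zero => exact hstep 0 (hp.1.trans hp'.1.symm)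
      | succ n ih => exact hstep _ (by rw [← (hp.2 n).2, ← (hp'.2 n).2, ih])
    rw [show p' = p from Stream'.ext heq, goal_opp]
    exact hlose

/-! ### Walks and the values of closed walks -/

section Walks

variable {G : Type*} [Group G] {val : C → G} {S : Set G}

/-- `Walk val D n u g w`: there is a path of length `n` from `u` to `w` with value `g`, all of whose
edges satisfy `D`. -/
inductive Walk (val : C → G) (D : Edge C V → Prop) : ℕ → V → G → V → Prop
  | nil (v : V) : Walk val D 0 v 1 v
  | cons {n : ℕ} {e : Edge C V} {g : G} {w : V} (he : D e) (h : Walk val D n e.target g w) :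
      Walk val D (n + 1) e.source (val e.col * g) w

variable {D : Edge C V → Prop}

lemma Walk.single {e : Edge C V} (he : D e) : Walk val D 1 e.source (val e.col) e.target := by
  simpa using Walk.cons (val := val) he (Walk.nil e.target)

lemma Walk.append {n k : ℕ} {u v w : V} {g h : G} (h1 : Walk val D n u g v)
    (h2 : Walk val D k v h w) : Walk val D (n + k) u (g * h) w := by
  induction h1 with
  | nil => simpa using h2
  | cons he _ ih =>
    rw [mul_assoc, Nat.add_right_comm]
    exact Walk.cons he (ih h2)

lemma prefixVal_cons (val : C → G) (c : C) (α : Stream' C) (n : ℕ) :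
    prefixVal val (Stream'.cons c α) (n + 1) = val c * prefixVal val α n := by
  simp [prefixVal, wordVal, Stream'.take_succ_cons]

lemma prefixVal_congr {α β : Stream' C} {n : ℕ} (h : ∀ k < n, α.get k = β.get k) :
    prefixVal val α n = prefixVal val β n := by
  induction n with
  | zero => simp
  | succ n ih => rw [prefixVal_succ, prefixVal_succ, ih fun k hk => h k (by omega),
      h n (by omega)]

lemma Walk.exists_edges (e₀ : Edge C V) {n : ℕ} {u w : V} {g : G} (h : Walk val D n u g w) :
    ∃ (p : Stream' (Edge C V)) (x : ℕ → V), x 0 = u ∧ x n = w ∧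
      (∀ k < n, D (p.get k) ∧ (p.get k).source = x k ∧ (p.get k).target = x (k + 1)) ∧
      prefixVal val (p.map Edge.col) n = g := by
  induction h with
  | nil v => exact ⟨fun _ => e₀, fun _ => v, rfl, rfl, by simp, by simp⟩
  | @cons n e g w he h ih =>
    obtain ⟨p, x, h0, hn, hk, hg⟩ := ih
    refine ⟨Stream'.cons e p, fun k => Nat.casesOn k e.source x, rfl, hn, ?_, ?_⟩
    · rintro (_ | k) hkn
      · exact ⟨he, rfl, h0.symm⟩
      · exact hk k (by omega)
    · rw [Stream'.map_cons, prefixVal_cons, hg]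

/-- If a player wins from a node by positional choices, then every closed walk through this node
that respects these choices has a good value: the play that repeats the closed walk forever is
won. -/
lemma PosWins.value_mem (hS : IsCycleCondition val (goalValues S P) (goal W P)) {n : ℕ} {v : V}
    {g : G} (h : A.PosWins W P f v) (hw : Walk val (A.Allowed P f) n v g v) (hn : 0 < n) :
    g ∈ goalValues S P := by
  obtain ⟨e₀, -⟩ := A.exists_edge v
  obtain ⟨p, x, h0, hx, hk, rfl⟩ := hw.exists_edges e₀
  have hmod : ∀ k, k % n < n := fun k => Nat.mod_lt k hn
  let r : Stream' (Edge C V) := fun k => p.get (k % n)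
  have hr : ∀ k, A.Allowed P f (r.get k) ∧ (r.get k).source = x (k % n) ∧
      (r.get k).target = x (k % n + 1) := fun k => hk _ (hmod k)
  have hplay : A.IsPlayFrom v r := by
    refine ⟨by rw [(hr 0).2.1, Nat.zero_mod, h0], fun k => ⟨(hr k).1.1, ?_⟩⟩
    rw [(hr k).2.2, (hr (k + 1)).2.1, ← Nat.mod_add_mod]
    rcases Nat.lt_or_ge (k % n + 1) n with hlt | hge
    · rw [Nat.mod_eq_of_lt hlt]
    · rw [show k % n + 1 = n by have := hmod k; omega, Nat.mod_self, hx, h0]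
  have hmem := h r hplay fun k => (hr k).1
  have hper : ∀ k, r.get (k + n) = r.get k := fun k =>
    congrArg p.get (Nat.add_mod_right k n)
  rw [hS.mem_iff_of_periodic (α := r.map Edge.col) hn fun k => congrArg Edge.col (hper k)] at hmem
  rwa [prefixVal_congr (α := p.map Edge.col) (β := r.map Edge.col) fun k hkn =>
    congrArg (fun l => (p.get l).col) (Nat.mod_eq_of_lt hkn).symm]

/-! ### Splitting the choices of a player at one node -/

/-- Let the outgoing edges of a node `v` of the opponent be distributed among two arenas, and let
the player `P` win from `v` in both of them by positional choices. Then `P` wins in the full arena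
with one bit of memory, which tells to which of the two arenas the last edge that left `v`
belongs.

The infixes between two visits to the same node with the same bit are good: such an infix is a
closed walk of one of the two arenas, or it splits at the visits to `v` into closed walks through
`v`, after conjugation by its part before the first visit to `v`. -/
lemma memWins_of_split [Finite V] (hS : IsCycleCondition val (goalValues S P) (goal W P))
    (B : Bool → Arena C V) (g : Bool → V → Edge C V) {v : V}
    (hown : ∀ c, (B c).owner = A.owner) (hv : A.owner v ≠ P)
    (hsub : ∀ c, (B c).edges ⊆ A.edges)
    (hother : ∀ c, ∀ e ∈ A.edges, e.source ≠ v → e ∈ (B c).edges)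
    (hcover : ∀ e ∈ A.edges, ∃ c, e ∈ (B c).edges)
    (hg : ∀ c, (B c).IsLegal P (g c)) (hwin : ∀ c, (B c).PosWins W P (g c) v)
    (c₀ : Bool) {s : V} (hs : (B c₀).PosWins W P (g c₀) s) : A.MemWins W P s := by
  classical
  choose! cls hcls using hcover
  refine ⟨Bool, c₀, fun c e => if e.source = v then cls e else c, g,
    fun c => (hg c).mono (hown c) (hsub c), fun p m hp hm0 hm hc => ?_⟩
  have hm_ne : ∀ n, (p.get n).source ≠ v → m (n + 1) = m n := fun n hn => by
    rw [hm]
    exact if_neg hn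
  -- Every edge is allowed in the arena that the memory tells after it.
  have hall : ∀ n, (B (m (n + 1))).Allowed P (g (m (n + 1))) (p.get n) := fun n => by
    by_cases hn : (p.get n).source = v
    · rw [show m (n + 1) = cls (p.get n) from (hm n).trans (if_pos hn)]
      exact ⟨hcls _ (hp.2 n).1, fun ho => (hv (by rwa [hown, hn] at ho)).elim⟩
    · rw [hm_ne n hn]
      exact ⟨hother _ _ (hp.2 n).1 hn, fun ho => (hc n).2 (by rwa [hown] at ho)⟩
  have hwins : ∀ n, (B (m n)).PosWins W P (g (m n)) (p.get n).source := fun n => by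
    induction n with
    | zero => rwa [hp.1, hm0]
    | succ n ih =>
      rw [← (hp.2 n).2]
      refine PosWins.target hS.prefixIndependent ?_ (hall n)
      by_cases hn : (p.get n).source = v
      · rw [hn]; exact hwin _
      · rw [hm_ne n hn]; exact ih
  -- The value of an infix `[i, j)`, without and with visits to `v` at times from `i` to `j - 1`.
  have hinfix : ∀ i k,
      (m (i + k) = m i ∧ Walk val ((B (m i)).Allowed P (g (m i))) k (p.get i).source
        (infixVal val (p.map Edge.col) i (i + k)) (p.get (i + k)).source) ∨
      ∃ x y z, infixVal val (p.map Edge.col) i (i + k) = x * y * z ∧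
        (∃ l, Walk val ((B (m i)).Allowed P (g (m i))) l (p.get i).source x v) ∧
        (y = 1 ∨ y ∈ goalValues S P) ∧
        ∃ l, 0 < l ∧ Walk val ((B (m (i + k))).Allowed P (g (m (i + k)))) l v z
          (p.get (i + k)).source := by
    intro i k
    induction k with
    | zero => exact Or.inl ⟨rfl, by simpa using Walk.nil _⟩
    | succ k ih =>
      have hlast := Walk.single (val := val) (hall (i + k))
      rw [(hp.2 _).2] at hlast
      have hval : infixVal val (p.map Edge.col) i (i + (k + 1)) =
          infixVal val (p.map Edge.col) i (i + k) * val (p.get (i + k)).col := infixVal_succ ..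
      rw [hval]
      by_cases hn : (p.get (i + k)).source = v
      · right
        rw [hn] at hlast
        rcases ih with ⟨-, hwalk⟩ | ⟨x, y, z, hxyz, hx, hy, l, hl, hz⟩
        · rw [hn] at hwalk
          exact ⟨_, 1, _, by rw [mul_one], ⟨_, hwalk⟩, Or.inl rfl, 1, one_pos, hlast⟩
        · rw [hn] at hz
          have hzS := (hwin _).value_mem hS hz hl
          refine ⟨x, y * z, _, by rw [hxyz, mul_assoc x], hx, Or.inr ?_, 1, one_pos, hlast⟩
          rcases hy with rfl | hy
          · rwa [one_mul]
          · exact hS.mul_mem _ hy _ hzS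
      · have hm' : m (i + (k + 1)) = m (i + k) := hm_ne _ hn
        rw [← Nat.add_assoc] at hm'
        rw [hm'] at hlast
        rw [← Nat.add_assoc, hm']
        rcases ih with ⟨hmi, hwalk⟩ | ⟨x, y, z, hxyz, hx, hy, l, hl, hz⟩
        · rw [hmi] at hlast
          exact Or.inl ⟨hmi, hwalk.append hlast⟩
        · exact Or.inr ⟨x, y, _, by rw [hxyz, mul_assoc], hx, hy, l + 1, by omega,
            hz.append hlast⟩
  refine hS.mem_of_infixes _ (V × Bool) (fun n => ((p.get n).source, m n)) fun i j hij hq => ?_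
  obtain ⟨k, rfl⟩ := Nat.exists_eq_add_of_lt hij
  simp only [Prod.mk.injEq] at hq
  rw [Nat.add_assoc] at hq ⊢
  rcases hinfix i (k + 1) with ⟨-, hwalk⟩ | ⟨x, y, z, hxyz, ⟨l', hx⟩, hy, l, hl, hz⟩
  · rw [← hq.1] at hwalk
    exact (hwins i).value_mem hS hwalk (by omega)
  · rw [← hq.1, ← hq.2] at hz
    have hzx := (hwin _).value_mem hS (hz.append hx) (by omega)
    have hyzx : y * (z * x) ∈ goalValues S P := by
      rcases hy with rfl | hy
      · rwa [one_mul]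
      · exact hS.mul_mem _ hy _ hzx
    rw [hxyz]
    simpa [mul_assoc] using hS.conj_mem _ hyzx x

/-- Let `B` be obtained from `A` by removing some of the choices of the player `P` at the node `v`,
and let `P` win from `v` in `B`. Then the opponent's choices that win from `s` in `B` also win
from `s` in `A`: a play with these choices never visits `v`. -/
lemma PosWins.of_restrict_opp {B : Arena C V} {v s : V} {g : V → Edge C V}
    (hW : PrefixIndependent (goal W P.opp)) (hown : B.owner = A.owner)
    (hother : ∀ e ∈ A.edges, e.source ≠ v → e ∈ B.edges)
    (hf : B.IsLegal P f) (hg : B.IsLegal P.opp g) (hwin : B.PosWins W P f v)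
    (hs : B.PosWins W P.opp g s) : A.PosWins W P.opp g s := by
  intro p hp hc
  have hstep : ∀ n, B.PosWins W P.opp g (p.get n).source → B.Allowed P.opp g (p.get n) := by
    refine fun n hn => ⟨hother _ (hp.2 n).1 fun hv => ?_, fun ho => (hc n).2 (by rwa [hown] at ho)⟩
    rw [hv] at hn
    exact (hwin.memWins hf).not_opp (hn.memWins hg)
  have hn : ∀ n, B.PosWins W P.opp g (p.get n).source := fun n => by
    induction n with
    | zero => rwa [hp.1]
    | succ n ih => rw [← (hp.2 n).2]; exact PosWins.target hW ih (hstep n ih)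
  exact hs p ⟨hp.1, fun n => ⟨(hstep n (hn n)).1, (hp.2 n).2⟩⟩ fun n => hstep n (hn n)

/-- If only choices of the player `P` have been removed, then choices of `P` that win in the
smaller arena win in the larger one. -/
lemma PosWins.of_restrict {B : Arena C V} {v s : V} (hown : B.owner = A.owner)
    (hv : A.owner v = P) (hother : ∀ e ∈ A.edges, e.source ≠ v → e ∈ B.edges)
    (hf : B.IsLegal P f) (hs : B.PosWins W P f s) : A.PosWins W P f s := by
  intro p hp hc
  have hB : ∀ n, p.get n ∈ B.edges := fun n => by
    by_cases hn : (p.get n).source = v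
    · rw [(hc n).2 (by rwa [hn]), hn]
      exact (hf v (by rwa [hown])).1
    · exact hother _ (hp.2 n).1 hn
  exact hs p ⟨hp.1, fun n => ⟨hB n, (hp.2 n).2⟩⟩
    fun n => ⟨hB n, fun ho => (hc n).2 (by rwa [hown] at ho)⟩

/-! ### Positional determinacy -/

/-- Both players have positional strategies such that from every node one of the two strategies
is winning. -/
def PosDetermined (A : Arena C V) (W : Set (Stream' C)) : Prop :=
  ∃ f : Player → V → Edge C V, (∀ P, A.IsLegal P (f P)) ∧ ∀ s, ∃ P, A.PosWins W P (f P) s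

/-- If the arenas with fewer edges are positionally determined, then each player has a positional
strategy that is optimal in the sense that from every node where it does not win, the opponent
has some winning strategy. -/
lemma exists_posWins_or_memWins [Finite V] (h : IsCycleCondition val S W)
    (ih : ∀ B : Arena C V, B.owner = A.owner → B.edges ⊂ A.edges → B.PosDetermined W)
    (P : Player) : ∃ f, A.IsLegal P f ∧ ∀ s, A.PosWins W P f s ∨ A.MemWins W P.opp s := by
  by_cases hu : ∀ e ∈ A.edges, ∀ e' ∈ A.edges, A.owner e.source = P → e.source = e'.source → e = e'
  · obtain ⟨f, hf⟩ := A.exists_isLegal P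
    exact ⟨f, hf, posWins_or_memWins_of_unique hu⟩
  push Not at hu
  obtain ⟨e, he, e', he', hv, hee', hne⟩ := hu
  -- Split the edges that leave the node into the edge `e` and all other edges.
  let B : Bool → Arena C V := fun c =>
    match c with
    | true =>
      { owner := A.owner
        edges := {x | x ∈ A.edges ∧ (x.source = e.source → x = e)}
        exists_edge := fun u => by
          by_cases hu : u = e.source
          · exact ⟨e, ⟨he, fun _ => rfl⟩, hu.symm⟩
          · obtain ⟨x, hx, hxu⟩ := A.exists_edge u
            exact ⟨x, ⟨hx, fun h => (hu (hxu.symm.trans h)).elim⟩, hxu⟩ }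
    | false =>
      { owner := A.owner
        edges := {x | x ∈ A.edges ∧ x ≠ e}
        exists_edge := fun u => by
          by_cases hu : u = e.source
          · exact ⟨e', ⟨he', hne.symm⟩, by rw [hu, hee']⟩
          · obtain ⟨x, hx, hxu⟩ := A.exists_edge u
            exact ⟨x, ⟨hx, by rintro rfl; exact hu hxu.symm⟩, hxu⟩ }
  have hown : ∀ c, (B c).owner = A.owner := by rintro (_ | _) <;> rfl
  have hsub : ∀ c, (B c).edges ⊆ A.edges := by rintro (_ | _) x hx <;> exact hx.1
  have hother : ∀ c, ∀ x ∈ A.edges, x.source ≠ e.source → x ∈ (B c).edges := by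
    rintro (_ | _) x hx hxv
    · exact ⟨hx, by rintro rfl; exact hxv rfl⟩
    · exact ⟨hx, fun h => (hxv h).elim⟩
  have hcover : ∀ x ∈ A.edges, ∃ c, x ∈ (B c).edges := fun x hx => by
    by_cases hxe : x = e
    · exact ⟨true, hx, fun _ => hxe⟩
    · exact ⟨false, hx, hxe⟩
  have hssub : ∀ c, (B c).edges ⊂ A.edges := by
    refine fun c => (hsub c).ssubset_of_ne fun h => ?_
    cases c
    · have : e ∈ (B false).edges := h ▸ he
      exact this.2 rfl
    · have : e' ∈ (B true).edges := h ▸ he'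
      exact hne (this.2 hee'.symm).symm
  choose f hf hwin using fun c => ih (B c) (hown c) (hssub c)
  by_cases hex : ∃ c, (B c).PosWins W P (f c P) e.source
  · obtain ⟨c, hc⟩ := hex
    refine ⟨f c P, (hf c P).mono (hown c) (hsub c), fun s => ?_⟩
    obtain ⟨Q, hQ⟩ := hwin c s
    rcases P.eq_or_eq_opp Q with rfl | rfl
    · exact Or.inl (hQ.of_restrict (hown c) hv (hother c) (hf c _))
    · refine Or.inr (PosWins.memWins (PosWins.of_restrict_opp (h.player _).prefixIndependent
        (hown c) (hother c) (hf c P) (hf c P.opp) hc hQ)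
        ((hf c P.opp).mono (hown c) (hsub c)))
  · have hopp : ∀ c, (B c).PosWins W P.opp (f c P.opp) e.source := fun c => by
      obtain ⟨Q, hQ⟩ := hwin c e.source
      rcases P.eq_or_eq_opp Q with rfl | rfl
      · exact (hex ⟨c, hQ⟩).elim
      · exact hQ
    refine ⟨f true P, (hf true P).mono (hown true) (hsub true), fun s => ?_⟩
    obtain ⟨Q, hQ⟩ := hwin true s
    rcases P.eq_or_eq_opp Q with rfl | rfl
    · exact Or.inl (hQ.of_restrict (hown _) hv (hother _) (hf _ _))
    · exact Or.inr (memWins_of_split (h.player _) B (fun c => f c P.opp) hown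
        (by rw [hv]; exact P.opp_ne.symm) hsub hother hcover (fun c => hf c _) hopp true hQ)

theorem posDetermined [Finite C] [Finite V] (h : IsCycleCondition val S W) (A : Arena C V) :
    A.PosDetermined W := by
  have : Finite (Edge C V) := Finite.of_injective
    (fun e : Edge C V => (e.source, e.col, e.target)) fun e e' h => by
      cases e; cases e'; simpa using h
  induction hE : A.edges using WellFoundedLT.induction generalizing A with
  | ind E ih =>
    have hhalf := exists_posWins_or_memWins (A := A) h
      fun B _ hB => ih _ (hE ▸ hB) B rfl
    choose f hf hwin using hhalf
    refine ⟨f, hf, fun s => ?_⟩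
    by_contra! hs
    have h1 := (hwin Player.alice s).resolve_left (hs _)
    exact h1.not_opp ((hwin Player.bob s).resolve_left (hs _))

end Walks

lemma endpoint_take {p : Stream' (Edge C V)} {s : V} (hp : A.IsPlayFrom s p) (n : ℕ) :
    endpoint s (p.take n) = (p.get n).source := by
  induction n generalizing s p with
  | zero => exact hp.1.symm
  | succ n ih =>
    rw [Stream'.take_succ]
    exact ih (p := p.tail) ⟨(hp.2 0).2.symm, fun k => hp.2 (k + 1)⟩

lemma PosWins.isWinning (σ : A.PositionalStrategy P) {s : V} (h : A.PosWins W P σ.move s) :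
    (σ.toStrategy s).IsWinning W := by
  intro p hp hc
  refine h p hp fun n => ⟨(hp.2 n).1, fun ho => ?_⟩
  rw [← endpoint_take hp n]
  exact hc n ho

end Arena

theorem IsCycleCondition.halfPositional {C G : Type} [Finite C] [Group G] {val : C → G}
    {S : Set G} {W : Set (Stream' C)} (h : IsCycleCondition val S W) : HalfPositional W := by
  intro V _ A
  obtain ⟨f, hf, hwin⟩ := Arena.posDetermined h A
  refine ⟨⟨f Player.alice, hf _⟩, fun s hs => ?_⟩
  obtain ⟨P, hP⟩ := hwin s
  cases P with
  | alice => exact (hs (hP.isWinning ⟨_, hf _⟩)).elim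
  | bob => exact ⟨_, hP.isWinning ⟨_, hf _⟩⟩

/-- Conditions that are decided by cycles are bi-positional, because the notion is symmetric under
complements. -/
theorem IsCycleCondition.biPositional {C G : Type} [Finite C] [Group G] {val : C → G}
    {S : Set G} {W : Set (Stream' C)} (h : IsCycleCondition val S W) : BiPositional W :=
  ⟨h.halfPositional, h.compl.halfPositional⟩

/-! ### The condition over the free group -/

instance : Finite Color :=
  Finite.of_surjective
    (fun i : Fin 5 => ![Color.a, Color.aInv, Color.b, Color.bInv, Color.eps] i) fun c => by
      cases c
      exacts [⟨0, rfl⟩, ⟨1, rfl⟩, ⟨2, rfl⟩, ⟨3, rfl⟩, ⟨4, rfl⟩]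

section Order

variable [LinearOrder F₂]

lemma isCycleCondition_W₁ (hG : IsBiOrdered F₂) :
    IsCycleCondition Color.val {g | g < 1} W₁ :=
  isCycleCondition_energyCondition hG _

lemma cycle_mem_W₁_of_lt (hG : IsBiOrdered F₂) (h : a * b * a⁻¹ * b⁻¹ < 1) :
    Stream'.cycle [Color.a, Color.b, Color.aInv, Color.bInv] (List.cons_ne_nil _ _) ∈ W₁ :=
  ((isCycleCondition_W₁ hG).cycle_mem_iff _ _).2 (by simpa [wordVal, Color.val, mul_assoc] using h)

lemma cycle_mem_W₁_of_gt (hG : IsBiOrdered F₂) (h : 1 < a * b * a⁻¹ * b⁻¹) :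
    Stream'.cycle [Color.b, Color.a, Color.bInv, Color.aInv] (List.cons_ne_nil _ _) ∈ W₁ := by
  have := hG.mulLeftMono
  rw [(isCycleCondition_W₁ hG).cycle_mem_iff]
  simpa [wordVal, Color.val, mul_assoc] using inv_lt_one'.2 h

lemma cycle_notMem_W₁ (hG : IsBiOrdered F₂) :
    Stream'.cycle [Color.a, Color.aInv, Color.b, Color.bInv] (List.cons_ne_nil _ _) ∉ W₁ := by
  rw [(isCycleCondition_W₁ hG).cycle_mem_iff]
  simp [wordVal, Color.val]

lemma not_permuting_W₁ (hG : IsBiOrdered F₂) : ¬ Permuting (W₁ : Set (Stream' Color)) := by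
  intro hP
  refine cycle_notMem_W₁ hG ?_
  rcases lt_or_gt_of_ne commutator_ne_one with h | h
  · exact hP _ _ _ _ (.cons _ (.swap _ _ _)) (cycle_mem_W₁_of_lt hG h)
  · refine hP _ _ _ _ ?_ (cycle_mem_W₁_of_gt hG h)
    exact (.trans (.swap _ _ _) (.cons _ (.trans (.cons _ (.swap _ _ _)) (.swap _ _ _))))

lemma biPositional_W₁ (hG : IsBiOrdered F₂) : BiPositional (W₁ : Set (Stream' Color)) :=
  (isCycleCondition_W₁ hG).biPositional

end Order

end EnergyGames

theorem mainTheorem5 :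
    -- the free group with two generators has a bi-order for which `a b a⁻¹ b⁻¹` is negative
    (∃ _ : LinearOrder EnergyGames.F₂, EnergyGames.IsBiOrdered EnergyGames.F₂ ∧
      EnergyGames.a * EnergyGames.b * EnergyGames.a⁻¹ * EnergyGames.b⁻¹ < 1) ∧
    -- properties of `W₁` for an arbitrary bi-order
    (∀ _ : LinearOrder EnergyGames.F₂, EnergyGames.IsBiOrdered EnergyGames.F₂ →
      EnergyGames.BiPositional EnergyGames.W₁ ∧
      EnergyGames.PrefixIndependent EnergyGames.W₁ ∧
      ¬ EnergyGames.Permuting EnergyGames.W₁ ∧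
      (EnergyGames.a * EnergyGames.b * EnergyGames.a⁻¹ * EnergyGames.b⁻¹ < 1 →
        Stream'.cycle [EnergyGames.Color.a, EnergyGames.Color.b, EnergyGames.Color.aInv,
          EnergyGames.Color.bInv] (List.cons_ne_nil _ _) ∈ EnergyGames.W₁ ∧
        Stream'.cycle [EnergyGames.Color.a, EnergyGames.Color.aInv, EnergyGames.Color.b,
          EnergyGames.Color.bInv] (List.cons_ne_nil _ _) ∉ EnergyGames.W₁) ∧
      -- otherwise one considers the inverse `b a b⁻¹ a⁻¹`
      (1 < EnergyGames.a * EnergyGames.b * EnergyGames.a⁻¹ * EnergyGames.b⁻¹ →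
        Stream'.cycle [EnergyGames.Color.b, EnergyGames.Color.a, EnergyGames.Color.bInv,
          EnergyGames.Color.aInv] (List.cons_ne_nil _ _) ∈ EnergyGames.W₁ ∧
        Stream'.cycle [EnergyGames.Color.a, EnergyGames.Color.aInv, EnergyGames.Color.b,
          EnergyGames.Color.bInv] (List.cons_ne_nil _ _) ∉ EnergyGames.W₁)) ∧
    -- the answer to the question
    (∃ (C : Type) (_ : Finite C) (_ : Nonempty C) (W : Set (Stream' C)),
      EnergyGames.BiPositional W ∧ EnergyGames.PrefixIndependent W ∧
        ¬ EnergyGames.Permuting W) := by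
  refine ⟨EnergyGames.exists_isBiOrdered_commutator_lt_one, fun _ hG =>
    ⟨EnergyGames.biPositional_W₁ hG, (EnergyGames.isCycleCondition_W₁ hG).prefixIndependent,
      EnergyGames.not_permuting_W₁ hG,
      fun h => ⟨EnergyGames.cycle_mem_W₁_of_lt hG h, EnergyGames.cycle_notMem_W₁ hG⟩,
      fun h => ⟨EnergyGames.cycle_mem_W₁_of_gt hG h, EnergyGames.cycle_notMem_W₁ hG⟩⟩, ?_⟩
  obtain ⟨_, hG⟩ := EnergyGames.exists_isBiOrdered_freeGroup
  exact ⟨EnergyGames.Color, inferInstance, ⟨EnergyGames.Color.eps⟩, EnergyGames.W₁,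
    EnergyGames.biPositional_W₁ hG, (EnergyGames.isCycleCondition_W₁ hG).prefixIndependent,
    EnergyGames.not_permuting_W₁ hG⟩
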